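/- Let $V$ be a euclidean vector space of dimension $n$, let $R\subset V^*$ be a root system (a finite set of nonzero functionals which spans $V^*$ and is stable under the reflections in its members; neither reducedness nor integrality is needed), let $W$ be the group generated by the orthogonal reflections of $V$ in the walls $\{\alpha=0\}$, $\alpha\in R$, and let $\alpha_1,\dots,\alpha_n\in R$ be a system of simple roots. Let $$\Delta=\{x\in V:\alpha_i(x)\ge 0,\ i=1,\dots,n\},\qquad \Delta^*=\{\lambda\in V^*:(\alpha_i,\lambda)\ge 0,\ i=1,\dots,n\}$$ be the Weyl chamber and the dual chamber, where $(\cdot,\cdot)$ is the inner product induced on $V^*$. Let $B\subset V$ be a $W$-invariant polytope (a compact intersection of finitely many closed half-spaces) with nonempty interior such that $\Delta\cap B=\{x\in\Delta: l(x)\le 1\}$ for some $l$ in the interior of $\Delta^*$, and let $B^*=\{\lambda\in V^*:\lambda(x)\le 1\ \forall x\in B\}$. Then for each $i$ there is exactly one vertex $\omega_i$ of $\Delta\cap B$ with $\alpha_i(\omega_i)\neq 0$, and $\Delta^*\cap B^*$ is a polytope. For $I,J\subseteq\{1,\dots,n\}$ put $$E_I=\{\lambda\in\Delta^*\cap B^*:\lambda(\omega_i)=1,\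 i\in I\},\qquad F_J=\{\lambda\in\Delta^*\cap B^*:(\lambda,\alpha_j)=0,\ j\in J\}.$$ Every set $E_I\cap F_J$ is a (possibly empty) face of $\Delta^*\cap B^*$, every nonempty face of $\Delta^*\cap B^*$ has this form, and $$c:\ E_I\cap F_J\ \longmapsto\ \{t\in[0,1]^n: t_i=1 \text{ for } i\in I,\ t_j=0\text{ for } j\in J\}$$ is a well-defined isomorphism from the face poset of $\Delta^*\cap B^*$ to the face poset of the cube $[0,1]^n$ (the empty face included). Moreover, $\Delta^*\cap B^*$ is combinatorially homeomorphic to $[0,1]^n$ in a way that realizes $c$: there is a piecewise linear homeomorphism $h:\Delta^*\cap B^*\to[0,1]^n$ with $h(F)=c(F)$ for every face $F$. -/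

import Mathlib

open scoped RealInnerProductSpace

section Polytopes

/-- A polytope: a compact (automatically convex) subset of a real topological vector space which
is the intersection of finitely many closed half-spaces `{x | f x ≤ c}`. -/
def IsPolytope {E : Type*} [TopologicalSpace E] [AddCommGroup E] [Module ℝ E] (P : Set E) : Prop :=
  IsCompact P ∧
    ∃ H : Set (StrongDual ℝ E × ℝ), H.Finite ∧ P = {x | ∀ p ∈ H, p.1 x ≤ p.2}

/-- `F` is a face of the polytope `P`: either `F` is empty, or `F` is the set of all points of `P`
at which some linear functional attains its maximum over `P` (the zero functional gives `P`). -/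
def IsFace {E : Type*} [TopologicalSpace E] [AddCommGroup E] [Module ℝ E] (P F : Set E) : Prop :=
  IsExposed ℝ P F

/-- The face poset of `P`, ordered by inclusion. -/
abbrev FacePoset {E : Type*} [TopologicalSpace E] [AddCommGroup E] [Module ℝ E] (P : Set E) :
    Type _ :=
  {F : Set E // IsFace P F}

/-- The image of a subset `F` of `P` under a map `h : P → Q`, as a subset of the ambient space. -/
def imageUnder {E E' : Type*} {P : Set E} {Q : Set E'} (h : P → Q) (F : Set E) : Set E' :=
  {y | ∃ x : P, (x : E) ∈ F ∧ (h x : E') = y}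

/-- A map `h : P → Q` is piecewise linear: `P` is a finite union of polytopes on each of which `h`
is the restriction of an affine map of the ambient spaces. -/
def IsPiecewiseLinear {E E' : Type*} [TopologicalSpace E] [AddCommGroup E] [Module ℝ E]
    [AddCommGroup E'] [Module ℝ E'] {P : Set E} {Q : Set E'} (h : P → Q) : Prop :=
  ∃ 𝒞 : Set (Set E), 𝒞.Finite ∧ (∀ C ∈ 𝒞, IsPolytope C) ∧ P = ⋃₀ 𝒞 ∧
    ∀ C ∈ 𝒞, ∃ A : E →ᵃ[ℝ] E', ∀ x : P, (x : E) ∈ C → (h x : E') = A x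

/-- The homeomorphism `h : P → Q` is a combinatorial homeomorphism of polytopes inducing the
isomorphism `c` of face posets: it is piecewise linear and maps each face `F` of `P` onto the face
`c F` of `Q`. -/
def IsCombinatorialHomeoInducing {E E' : Type*} [TopologicalSpace E] [AddCommGroup E] [Module ℝ E]
    [TopologicalSpace E'] [AddCommGroup E'] [Module ℝ E'] {P : Set E} {Q : Set E'}
    (h : P ≃ₜ Q) (c : FacePoset P ≃o FacePoset Q) : Prop :=
  IsPiecewiseLinear h ∧ ∀ F : FacePoset P, imageUnder h (F : Set E) = (c F : Set E')

/-- The polar `B* = {λ | λ(x) ≤ 1 for all x ∈ B}` of `B`, in the dual space. -/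
def polarBody {E : Type*} [TopologicalSpace E] [AddCommGroup E] [Module ℝ E] (B : Set E) :
    Set (StrongDual ℝ E) :=
  {lam | ∀ x ∈ B, lam x ≤ 1}

/-- The cube `[0,1]ⁿ`. -/
def unitCube (n : ℕ) : Set (Fin n → ℝ) :=
  {t | ∀ i, 0 ≤ t i ∧ t i ≤ 1}

/-- The face `{t_i = 1, i ∈ I} ∩ {t_j = 0, j ∈ J}` of the cube. -/
def cubeFace {n : ℕ} (I J : Set (Fin n)) : Set (Fin n → ℝ) :=
  {t ∈ unitCube n | (∀ i ∈ I, t i = 1) ∧ ∀ j ∈ J, t j = 0}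

end Polytopes

noncomputable section RootSystems

variable {V : Type*} [NormedAddCommGroup V] [InnerProductSpace ℝ V] [FiniteDimensional ℝ V]

/-- The vector representing a linear functional through the inner product:
`⟪gradVec lam, x⟫ = lam x`. -/
def gradVec (lam : StrongDual ℝ V) : V :=
  haveI : CompleteSpace V := FiniteDimensional.complete ℝ V
  (InnerProductSpace.toDual ℝ V).symm lam

/-- The inner product `(lam, mu)` on the dual space induced by the one of `V`. -/
def dualInner (lam mu : StrongDual ℝ V) : ℝ :=
  ⟪gradVec lam, gradVec mu⟫

/-- The orthogonal reflection `s_α` of `V` in the wall `α = 0`. -/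
def wallReflection (α : StrongDual ℝ V) : V ≃ₗᵢ[ℝ] V :=
  (ℝ ∙ gradVec α)ᗮ.reflection

variable (V) in
/-- A root system in the dual of the euclidean space `V`: a finite spanning set of nonzero
functionals stable under the reflections in its members. Neither reducedness nor integrality is
required. -/
structure EuclideanRootSystem where
  /-- The set of roots. -/
  roots : Set (StrongDual ℝ V)
  finite : roots.Finite
  span_eq_top : Submodule.span ℝ roots = ⊤
  ne_zero : ∀ α ∈ roots, α ≠ 0
  reflection_mem : ∀ α ∈ roots, ∀ β ∈ roots,
    β - (2 * dualInner α β / dualInner α α) • α ∈ roots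

/-- The Weyl group `W`, generated by the reflections in the roots. -/
def EuclideanRootSystem.weylGroup (R : EuclideanRootSystem V) : Subgroup (V ≃ₗᵢ[ℝ] V) :=
  Subgroup.closure (wallReflection '' R.roots)

/-- A system of simple roots `α_1, …, α_n`: roots which form a basis of the dual space, such that
each root is a linear combination of them with all coefficients `≥ 0` or all coefficients `≤ 0`.
Choosing it amounts to choosing a Weyl chamber. -/
structure SimpleRoots (R : EuclideanRootSystem V) (n : ℕ) where
  /-- The simple roots, as a basis of the dual space. -/
  root : Module.Basis (Fin n) ℝ (StrongDual ℝ V)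
  root_mem : ∀ i, root i ∈ R.roots
  nonneg_or_nonpos : ∀ β ∈ R.roots, (∀ i, 0 ≤ root.repr β i) ∨ (∀ i, root.repr β i ≤ 0)

namespace SimpleRoots

variable {R : EuclideanRootSystem V} {n : ℕ} (S : SimpleRoots R n)

/-- The Weyl chamber `Δ = {x | α_i(x) ≥ 0 for all i}`. -/
def chamber : Set V :=
  {x | ∀ i, 0 ≤ S.root i x}

/-- The dual chamber `Δ* = {lam | (α_i, lam) ≥ 0 for all i}`. -/
def dualChamber : Set (StrongDual ℝ V) :=
  {lam | ∀ i, 0 ≤ dualInner (S.root i) lam}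

/-- `v` is a vertex of `Δ ∩ B` on which `α_i` does not vanish. -/
def IsVertexOff (B : Set V) (i : Fin n) (v : V) : Prop :=
  v ∈ (S.chamber ∩ B).extremePoints ℝ ∧ S.root i v ≠ 0

/-- The polytope `Δ* ∩ B*`. -/
def dualPiece (B : Set V) : Set (StrongDual ℝ V) :=
  S.dualChamber ∩ polarBody B

/-- The exterior face `E_I` of `Δ* ∩ B*`: the points `lam` with `lam(ω_i) = 1` for `i ∈ I`. -/
def exteriorFace (B : Set V) (ω : Fin n → V) (I : Set (Fin n)) : Set (StrongDual ℝ V) :=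
  {lam ∈ S.dualPiece B | ∀ i ∈ I, lam (ω i) = 1}

/-- The interior face `F_J` of `Δ* ∩ B*`: the points `lam` with `(lam, α_j) = 0` for `j ∈ J`. -/
def interiorFace (B : Set V) (J : Set (Fin n)) : Set (StrongDual ℝ V) :=
  {lam ∈ S.dualPiece B | ∀ j ∈ J, dualInner lam (S.root j) = 0}

end SimpleRoots

end RootSystems

/-! Let `v_i` be the vertex of the simplex `Δ ∩ B` on the ray opposite the wall `α_i = 0`, and use
the coordinates `z_i = λ(v_i)` on the dual space. Simple roots are pairwise obtuse, so `(α_i, λ) ≥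
0` reads `(b z)_i ≤ z_i` for a matrix `b` with nonnegative entries. The functional `l` has all
coordinates 1 and lies in the interior of `Δ*`, so every row sum of `b` is below 1, hence at most
some `β < 1`. For dominant `λ` the bound `λ ≤ 1` on `B` only needs checking on `Δ ∩ B`
(`exists_mem_chamber_apply_ge`), that is, at the `v_i`. Thus `Δ* ∩ B*` is the cell `b z ≤ z ≤ 1`
(`dualPiece_eq_dominantCell`).

The map `t_i = min (z_i, (z_i - (b z)_i) / (1 - β))` sends this cell to the cube; `t_i` is 0 or 1
exactly when the lower or upper bound on `z_i` is tight. For given `t`, the equation becomes `z =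
max (t, b z + (1 - β) t)`, a `β`-contraction in the sup norm, so the map is bijective
(`existsUnique_toCube_eq`). Nonempty faces of either polytope are sets of prescribed tight
constraints, so the map matches the faces. -/

/-! ### Exposed faces of a polyhedron and tight constraints -/

section ExposedFaces

variable {E ι : Type*} [NormedAddCommGroup E] [NormedSpace ℝ E] [Fintype ι]

/-- The points of the polyhedron `{x | ∀ k, f k x ≤ r k}` at which the constraints in `K` are
tight. -/
def tightSet (f : ι → StrongDual ℝ E) (r : ι → ℝ) (K : Set ι) : Set E :=
  {x | (∀ k, f k x ≤ r k) ∧ ∀ k ∈ K, f k x = r k}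

/-- The sum of the functionals in `K` exposes the set: it reaches the sum of their bounds only where
each of them is tight. -/
theorem isExposed_tightSet (f : ι → StrongDual ℝ E) (r : ι → ℝ) (K : Set ι) :
    IsExposed ℝ {x | ∀ k, f k x ≤ r k} (tightSet f r K) := by
  classical
  rintro ⟨p, hp, hpK⟩
  refine ⟨∑ k with k ∈ K, f k, ?_⟩
  have key (x : E) : (∑ k with k ∈ K, f k) x = ∑ k with k ∈ K, f k x := by
    simp
  ext x
  simp only [tightSet, Set.mem_ofPred_eq, key]
  refine and_congr_right fun hx => ⟨fun h y hy => ?_, fun h k hk => ?_⟩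
  · refine Finset.sum_le_sum fun k hk => ?_
    rw [h k (by simpa using hk)]
    exact hy k
  · have h1 := h p hp
    by_contra hne
    refine absurd h1 (not_le.2 (Finset.sum_lt_sum (fun j hj => ?_) ⟨k, by simpa using hk, ?_⟩))
    · rw [hpK j (by simpa using hj)]
      exact hx j
    · rw [hpK k hk]
      exact lt_of_le_of_ne (hx k) hne

/-- A point `p` of `F` with fewest tight constraints plays the role of a relative interior point.
Midpoints show that its tight constraints hold with equality on all of `F`; conversely, if they are
tight at `x`, the segment from `x` to `p` extends beyond `p` inside the polyhedron, so the exposing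
functional is maximal at `x` too. -/
theorem exists_eq_tightSet_of_isExposed {f : ι → StrongDual ℝ E} {r : ι → ℝ} {F : Set E}
    (hF : IsExposed ℝ {x | ∀ k, f k x ≤ r k} F) (hne : F.Nonempty) :
    ∃ K : Set ι, F = tightSet f r K := by
  classical
  obtain ⟨g, hg⟩ := hF hne
  have hsub : ∀ x ∈ F, ∀ k, f k x ≤ r k := fun x hx => hF.subset hx
  let T : E → Finset ι := fun x => {k | f k x = r k}
  obtain ⟨p, hp, hmin⟩ : ∃ p ∈ F, ∀ q ∈ F, (T p).card ≤ (T q).card := by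
    obtain ⟨p, hp, h⟩ := WellFounded.has_min (measure fun x => (T x).card).wf F hne
    exact ⟨p, hp, fun q hq => not_lt.1 (h q hq)⟩
  have hT : ∀ q ∈ F, T p ⊆ T q := by
    intro q hq k hk
    by_contra hkq
    have hmid : midpoint ℝ p q ∈ F := by
      have hconv : Convex ℝ F := hF.convex (by
        simp only [Set.ofPred_forall]
        exact convex_iInter fun k => convex_halfSpace_le (f k).toLinearMap.isLinear _)
      exact hconv.midpoint_mem hp hq
    have hval (j : ι) : f j (midpoint ℝ p q) = (f j p + f j q) / 2 := by
      rw [midpoint_eq_smul_add, map_smul, map_add, smul_eq_mul, invOf_eq_inv]; ring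
    refine absurd (hmin _ hmid) (not_le.2 (Finset.card_lt_card ?_))
    rw [Finset.ssubset_iff_of_subset]
    · refine ⟨k, hk, fun hkm => hkq ?_⟩
      simp only [T, Finset.mem_filter, Finset.mem_univ, true_and, hval] at hk hkm ⊢
      linarith
    · intro j hj
      simp only [T, Finset.mem_filter, Finset.mem_univ, true_and, hval] at hj ⊢
      linarith [hsub p hp j, hsub q hq j]
  refine ⟨T p, Set.Subset.antisymm (fun x hx => ⟨hsub x hx, fun k hk => ?_⟩) ?_⟩
  · simpa [T] using hT x hx hk
  rintro x ⟨hx, hxT⟩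
  have hp' := hp
  rw [hg] at hp' ⊢
  -- Constraints slack at `p` survive a small move away from `x`; those tight at `p` are constant
  -- along the line.
  have hmem : ∀ᶠ ε : ℝ in nhds 0, ∀ k, k ∉ T p → f k (p + ε • (p - x)) < r k := by
    rw [Filter.eventually_all]
    intro k
    by_cases hk : k ∈ T p
    · simp [hk]
    have hlt : f k (p + (0 : ℝ) • (p - x)) < r k := by
      simpa using lt_of_le_of_ne (hsub p hp k) (by simpa [T] using hk)
    have hc : Continuous fun ε : ℝ => f k (p + ε • (p - x)) := by fun_prop
    filter_upwards [hc.continuousAt.eventually (gt_mem_nhds hlt)] with ε h _ using h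
  obtain ⟨ε, hε, hε0⟩ := ((hmem.filter_mono nhdsWithin_le_nhds).and
    (self_mem_nhdsWithin : Set.Ioi (0 : ℝ) ∈ nhdsWithin 0 (Set.Ioi 0))).exists
  have hq := hp'.2 (p + ε • (p - x)) (fun k => by
    by_cases hk : k ∈ T p
    · have h1 : f k p = r k := by simpa [T] using hk
      have h2 := hxT k hk
      simp [h1, h2]
    · exact (hε k hk).le)
  have hgx : g p ≤ g x := by
    simp only [map_add, map_smul, map_sub, smul_eq_mul] at hq
    have : ε * (g p - g x) ≤ 0 := by linarith
    nlinarith [show (0 : ℝ) < ε from hε0]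
  exact ⟨hx, fun y hy => (hp'.2 y hy).trans hgx⟩

end ExposedFaces

/-! ### The cell `b z ≤ z ≤ 1` and its map to the cube -/

section DominantCell

variable {E : Type*} [NormedAddCommGroup E] [NormedSpace ℝ E] {n : ℕ}

/-- The polyhedron cut out by the inequalities `(b z)_i ≤ z_i ≤ 1` in linear coordinates `z = ζ x`.
The cube is the case `b = 0`. -/
def dominantCell (ζ : E ≃L[ℝ] (Fin n → ℝ)) (b : Matrix (Fin n) (Fin n) ℝ) : Set E :=
  {x | ∀ i, b.mulVec (ζ x) i ≤ ζ x i ∧ ζ x i ≤ 1}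

/-- The part of the cell where the upper bounds in `I` and the lower bounds in `J` are attained. -/
def dominantFace (ζ : E ≃L[ℝ] (Fin n → ℝ)) (b : Matrix (Fin n) (Fin n) ℝ) (I J : Set (Fin n)) :
    Set E :=
  {x ∈ dominantCell ζ b | (∀ i ∈ I, ζ x i = 1) ∧ ∀ j ∈ J, b.mulVec (ζ x) j = ζ x j}

variable (ζ : E ≃L[ℝ] (Fin n → ℝ)) (b : Matrix (Fin n) (Fin n) ℝ)

/-- The `i`-th coordinate functional. -/
def coordFunctional (i : Fin n) : StrongDual ℝ E :=
  (ContinuousLinearMap.proj i).comp ζ.toContinuousLinearMap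

/-- The functional `x ↦ (b z)_i` for `z = ζ x`. -/
def rowFunctional (i : Fin n) : StrongDual ℝ E :=
  ∑ j, b i j • coordFunctional ζ j

@[simp]
theorem coordFunctional_apply (i : Fin n) (x : E) : coordFunctional ζ i x = ζ x i := rfl

@[simp]
theorem rowFunctional_apply (i : Fin n) (x : E) :
    rowFunctional ζ b i x = b.mulVec (ζ x) i := by
  simp [rowFunctional, Matrix.mulVec, dotProduct]

/-- The functionals bounding the cell: the upper bounds, then the lower bounds. -/
def cellFunctional : Fin n ⊕ Fin n → StrongDual ℝ E :=
  Sum.elim (coordFunctional ζ) fun i => rowFunctional ζ b i - coordFunctional ζ i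

/-- The values bounding `cellFunctional` on the cell. -/
def cellBound : Fin n ⊕ Fin n → ℝ :=
  Sum.elim (fun _ => 1) fun _ => 0

theorem dominantCell_eq :
    dominantCell ζ b = {x | ∀ k, cellFunctional ζ b k x ≤ cellBound k} := by
  ext x
  simp [dominantCell, cellFunctional, cellBound, forall_and, and_comm]

theorem dominantFace_eq (I J : Set (Fin n)) :
    dominantFace ζ b I J =
      tightSet (cellFunctional ζ b) cellBound (Sum.inl '' I ∪ Sum.inr '' J) := by
  ext x
  have h := Set.ext_iff.1 (dominantCell_eq ζ b) x
  simp only [Set.mem_ofPred_eq] at h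
  simp only [dominantFace, tightSet, Set.mem_ofPred_eq, h]
  simp [cellFunctional, cellBound, sub_eq_zero]

theorem isFace_dominantFace (I J : Set (Fin n)) :
    IsFace (dominantCell ζ b) (dominantFace ζ b I J) := by
  rw [dominantFace_eq, dominantCell_eq]
  exact isExposed_tightSet _ _ _

theorem exists_eq_dominantFace {F : Set E} (hF : IsFace (dominantCell ζ b) F) (hne : F.Nonempty) :
    ∃ I J, F = dominantFace ζ b I J := by
  rw [dominantCell_eq] at hF
  obtain ⟨K, rfl⟩ := exists_eq_tightSet_of_isExposed hF hne
  refine ⟨Sum.inl ⁻¹' K, Sum.inr ⁻¹' K, ?_⟩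
  rw [dominantFace_eq]
  congr 1
  ext (k | k) <;> simp

variable {b} {β : ℝ} (hb : ∀ i j, 0 ≤ b i j) (hβ : ∀ i, ∑ j, b i j ≤ β) (hβ1 : β < 1)
include hb hβ

theorem mulVec_le_of_le {z : Fin n → ℝ} {m : ℝ} (hm : 0 ≤ m) (hz : ∀ i, z i ≤ m) (i : Fin n) :
    b.mulVec z i ≤ β * m := by
  calc b.mulVec z i = ∑ j, b i j * z j := rfl
    _ ≤ ∑ j, b i j * m := Finset.sum_le_sum fun j _ => mul_le_mul_of_nonneg_left (hz j) (hb i j)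
    _ = (∑ j, b i j) * m := by rw [Finset.sum_mul]
    _ ≤ β * m := mul_le_mul_of_nonneg_right (hβ i) hm

include hβ1

/-- Minimum principle: at a smallest coordinate, a negative `z_k` would satisfy `z_k ≥ (b z)_k ≥ β
z_k`, contradicting `β < 1`. -/
theorem nonneg_of_mulVec_le {z : Fin n → ℝ} (hz : ∀ i, b.mulVec z i ≤ z i) (i : Fin n) :
    0 ≤ z i := by
  have : Nonempty (Fin n) := ⟨i⟩
  obtain ⟨k, hk⟩ := Finite.exists_min z
  refine le_trans ?_ (hk i)
  by_contra! hneg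
  have h := mulVec_le_of_le hb hβ (z := -z) (m := -z k) (by linarith)
    (fun i => by simpa using hk i) k
  rw [Matrix.mulVec_neg, Pi.neg_apply] at h
  nlinarith [hz k]

theorem isCompact_dominantCell : IsCompact (dominantCell ζ b) := by
  have hcl : IsClosed (dominantCell ζ b) := by
    rw [dominantCell_eq]
    simp only [Set.ofPred_forall]
    exact isClosed_iInter fun k => isClosed_le (by fun_prop) continuous_const
  have hsub : dominantCell ζ b ⊆ ζ ⁻¹' Set.Icc 0 1 := fun x hx =>
    ⟨fun i => nonneg_of_mulVec_le hb hβ hβ1 (fun i => (hx i).1) i, fun i => (hx i).2⟩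
  exact (ζ.toHomeomorph.isClosedEmbedding.isCompact_preimage isCompact_Icc).of_isClosed_subset
    hcl hsub

theorem isPolytope_dominantCell : IsPolytope (dominantCell ζ b) := by
  refine ⟨isCompact_dominantCell ζ hb hβ hβ1,
    Set.range fun k => (cellFunctional ζ b k, cellBound k), Set.finite_range _, ?_⟩
  rw [dominantCell_eq]
  ext x
  simp only [Set.mem_ofPred_eq, Set.forall_mem_range]

omit hb hβ hβ1 in
variable (b) (β) in
/-- The piecewise linear map from the cell to the cube. -/
noncomputable def toCube (x : E) (i : Fin n) : ℝ :=
  min (ζ x i) ((ζ x i - b.mulVec (ζ x) i) / (1 - β))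

theorem toCube_mem {x : E} (hx : x ∈ dominantCell ζ b) : toCube ζ b β x ∈ unitCube n := by
  intro i
  refine ⟨le_min (nonneg_of_mulVec_le hb hβ hβ1 (fun i => (hx i).1) i) ?_,
    (min_le_left _ _).trans (hx i).2⟩
  exact div_nonneg (by linarith [(hx i).1]) (by linarith)

/-- If the minimum is `z_i = 0`, then `0 ≤ (b z)_i ≤ z_i` makes the lower bound tight as well. -/
theorem toCube_eq_zero_iff {x : E} (hx : x ∈ dominantCell ζ b) (i : Fin n) :
    toCube ζ b β x i = 0 ↔ b.mulVec (ζ x) i = ζ x i := by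
  have h0 := nonneg_of_mulVec_le hb hβ hβ1 fun i => (hx i).1
  have hbz : 0 ≤ b.mulVec (ζ x) i := by
    simp only [Matrix.mulVec, dotProduct]
    exact Finset.sum_nonneg fun j _ => mul_nonneg (hb i j) (h0 j)
  have h1 : 0 < 1 - β := by linarith
  constructor
  · intro h
    rcases min_choice (ζ x i) ((ζ x i - b.mulVec (ζ x) i) / (1 - β)) with h' | h'
    · have : ζ x i = 0 := by rw [← h']; exact h
      linarith [(hx i).1]
    · have : (ζ x i - b.mulVec (ζ x) i) / (1 - β) = 0 := by rw [← h']; exact h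
      rw [div_eq_zero_iff] at this
      rcases this with h | h <;> linarith
  · intro h
    simp [toCube, h, h0 i]

/-- The normalisation by `1 - β` serves here: `z_i = 1` leaves a gap `z_i - (b z)_i ≥ 1 - β`, so the
second term is at least 1. -/
theorem toCube_eq_one_iff {x : E} (hx : x ∈ dominantCell ζ b) (i : Fin n) :
    toCube ζ b β x i = 1 ↔ ζ x i = 1 := by
  have h1 : 0 < 1 - β := by linarith
  constructor
  · intro h
    exact le_antisymm (hx i).2 (h ▸ min_le_left _ _)
  · intro h
    have := mulVec_le_of_le hb hβ zero_le_one (fun i => (hx i).2) i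
    rw [toCube, h, min_eq_left]
    rw [le_div_iff₀ h1]
    linarith

-- With `L = (b z)_i` held fixed, both terms of the minimum increase with `z_i`; so their minimum is
-- `t_i` exactly when `z_i` is the maximum of their inverses at `t_i`.
omit hb hβ in
theorem toCube_eq_iff {x : E} {t : Fin n → ℝ} :
    toCube ζ b β x = t ↔
      (fun i => max (t i) (b.mulVec (ζ x) i + (1 - β) * t i)) = ζ x := by
  have h1 : 0 < 1 - β := by linarith
  simp only [funext_iff, toCube]
  refine forall_congr' fun i => ?_
  generalize ζ x i = z
  generalize b.mulVec (ζ x) i = L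
  constructor
  · rintro h
    rcases le_total z ((z - L) / (1 - β)) with h' | h'
    · rw [min_eq_left h'] at h
      rw [le_div_iff₀ h1] at h'
      subst h
      rw [max_eq_left]
      linarith
    · rw [min_eq_right h'] at h
      rw [div_le_iff₀ h1] at h'
      rw [div_eq_iff h1.ne'] at h
      rw [max_eq_right] <;> nlinarith
  · rintro h
    rcases le_total (t i) (L + (1 - β) * t i) with h' | h'
    · rw [max_eq_right h'] at h
      have : (z - L) / (1 - β) = t i := by
        rw [div_eq_iff h1.ne']
        linarith
      rw [this, min_eq_right]
      linarith
    · rw [max_eq_left h'] at h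
      subst h
      rw [min_eq_left]
      rw [le_div_iff₀ h1]
      linarith

/-- Every point of the cube has exactly one preimage under `toCube`, the fixed point of a
contraction. -/
theorem existsUnique_toCube_eq (hβ0 : 0 ≤ β) (t : Fin n → ℝ) : ∃! x : E, toCube ζ b β x = t := by
  let Φ : (Fin n → ℝ) → Fin n → ℝ := fun z i => max (t i) (b.mulVec z i + (1 - β) * t i)
  -- The metric is the sup metric: taking a maximum with a constant is 1-Lipschitz, and `b`
  -- contracts by its row sums.
  have hΦ : ContractingWith ⟨β, hβ0⟩ Φ := by
    refine ⟨NNReal.coe_lt_coe.1 hβ1, LipschitzWith.of_dist_le_mul fun z w => ?_⟩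
    change _ ≤ β * _
    refine (dist_pi_le_iff (by positivity)).2 fun i => ?_
    have hd := mulVec_le_of_le hb hβ (z := fun j => |z j - w j|) (m := dist z w) dist_nonneg
      (fun j => (Real.dist_eq _ _ ▸ dist_le_pi_dist z w j)) i
    refine le_trans ?_ hd
    rw [Real.dist_eq]
    refine (abs_max_sub_max_le_max _ _ _ _).trans ?_
    have : |b.mulVec z i - b.mulVec w i| ≤ b.mulVec (fun j => |z j - w j|) i := by
      simp only [Matrix.mulVec, dotProduct, ← Finset.sum_sub_distrib, ← mul_sub]
      refine (Finset.abs_sum_le_sum_abs _ _).trans (le_of_eq ?_)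
      exact Finset.sum_congr rfl fun j _ => by rw [abs_mul, abs_of_nonneg (hb i j)]
    refine max_le ?_ ?_
    · simpa using (abs_nonneg _).trans this
    · simpa using this
  refine ⟨ζ.symm hΦ.fixedPoint, ?_, fun y hy => ?_⟩
  · simp only [toCube_eq_iff ζ hβ1, ζ.apply_symm_apply]
    exact hΦ.fixedPoint_isFixedPt
  · rw [ContinuousLinearEquiv.eq_symm_apply]
    exact hΦ.fixedPoint_unique ((toCube_eq_iff ζ hβ1).1 hy)

/-- Both bounds come from the fixed-point equation. The upper one is a maximum principle: a largest
coordinate `z_k > 1` would equal `t_k ≤ 1` or be at most `β z_k + (1 - β)`. -/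
theorem mem_dominantCell_of_toCube_mem {x : E} (hx : toCube ζ b β x ∈ unitCube n) :
    x ∈ dominantCell ζ b := by
  have hfix := congrFun ((toCube_eq_iff ζ hβ1 (b := b) (x := x)).1 rfl)
  have h1 : 0 < 1 - β := by linarith
  intro i
  constructor
  · refine le_trans ?_ ((le_max_right _ _).trans (hfix i).le)
    linarith [mul_nonneg h1.le (hx i).1]
  · have : Nonempty (Fin n) := ⟨i⟩
    obtain ⟨k, hk⟩ := Finite.exists_max (ζ x)
    refine (hk i).trans ?_
    by_contra! hgt
    have hb' := mulVec_le_of_le hb hβ (by linarith) hk k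
    have ht := (hx k).2
    have := hfix k
    rcases max_choice (toCube ζ b β x k) (b.mulVec (ζ x) k + (1 - β) * toCube ζ b β x k) with h | h
    · linarith
    · nlinarith

omit hb hβ hβ1 in
theorem continuous_toCube : Continuous (toCube ζ b β) := by
  refine continuous_pi fun i => ?_
  have h : Continuous fun x => ζ x i := (coordFunctional ζ i).continuous
  have h' : Continuous fun x => b.mulVec (ζ x) i := by
    simpa only [← rowFunctional_apply] using (rowFunctional ζ b i).continuous
  exact h.min ((h.sub h').div_const _)

/-- The bijection from the cell to the cube. -/
noncomputable def cellEquiv (hβ0 : 0 ≤ β) : dominantCell ζ b ≃ unitCube n :=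
  Equiv.ofBijective (Set.MapsTo.restrict (toCube ζ b β) _ _ fun _ => toCube_mem ζ hb hβ hβ1)
    ⟨fun _ _ h => Subtype.ext
      ((existsUnique_toCube_eq ζ hb hβ hβ1 hβ0 _).unique (congrArg Subtype.val h) rfl),
    fun t => by
      obtain ⟨x, hx, -⟩ := existsUnique_toCube_eq ζ hb hβ hβ1 hβ0 t
      exact ⟨⟨x, mem_dominantCell_of_toCube_mem ζ hb hβ hβ1 (hx ▸ t.2)⟩, Subtype.ext hx⟩⟩

theorem continuous_cellEquiv (hβ0 : 0 ≤ β) : Continuous (cellEquiv ζ hb hβ hβ1 hβ0) :=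
  ((continuous_toCube ζ).comp continuous_subtype_val).subtype_mk _

/-- The piecewise linear homeomorphism from the cell to the cube. -/
noncomputable def cellHomeo (hβ0 : 0 ≤ β) : dominantCell ζ b ≃ₜ unitCube n :=
  haveI := isCompact_iff_compactSpace.1 (isCompact_dominantCell ζ hb hβ hβ1)
  (continuous_cellEquiv ζ hb hβ hβ1 hβ0).homeoOfEquivCompactToT2

@[simp]
theorem cellHomeo_apply (hβ0 : 0 ≤ β) (x : dominantCell ζ b) :
    (cellHomeo ζ hb hβ hβ1 hβ0 x : Fin n → ℝ) = toCube ζ b β x := rfl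

theorem isPiecewiseLinear_cellHomeo (hβ0 : 0 ≤ β) :
    IsPiecewiseLinear (cellHomeo ζ hb hβ hβ1 hβ0) := by
  classical
  have h1 : 0 < 1 - β := by linarith
  let g (i : Fin n) : StrongDual ℝ E :=
    (1 - β)⁻¹ • (coordFunctional ζ i - rowFunctional ζ b i)
  have hg (i : Fin n) (x : E) : g i x = (ζ x i - b.mulVec (ζ x) i) / (1 - β) := by
    simp [g, div_eq_inv_mul]
  -- The pieces are indexed by the set `σ` of coordinates in which the first term attains the
  -- minimum.
  let d (σ : Set (Fin n)) (i : Fin n) : StrongDual ℝ E :=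
    if i ∈ σ then coordFunctional ζ i - g i else g i - coordFunctional ζ i
  let C (σ : Set (Fin n)) : Set E := {x ∈ dominantCell ζ b | ∀ i, d σ i x ≤ 0}
  have hcov : dominantCell ζ b = ⋃₀ Set.range C := by
    refine Set.Subset.antisymm (fun x hx => ?_) (Set.sUnion_subset ?_)
    · refine ⟨_, ⟨{i | coordFunctional ζ i x ≤ g i x}, rfl⟩, hx, fun i => ?_⟩
      by_cases h : coordFunctional ζ i x ≤ g i x
      · simp only [d, Set.mem_ofPred_eq, h, if_true, sub_apply, sub_nonpos]
      · simpa only [d, Set.mem_ofPred_eq, h, if_false, sub_apply, sub_nonpos]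
          using (not_le.1 h).le
    · rintro _ ⟨σ, rfl⟩
      exact fun x hx => hx.1
  refine ⟨Set.range C, Set.finite_range C, ?_, hcov, ?_⟩
  · rintro _ ⟨σ, rfl⟩
    obtain ⟨hc, H, hH, hHeq⟩ := isPolytope_dominantCell ζ hb hβ hβ1
    refine ⟨?_, H ∪ Set.range fun i => (d σ i, 0), hH.union (Set.finite_range _), ?_⟩
    · have : C σ = dominantCell ζ b ∩ ⋂ i, {x | d σ i x ≤ 0} := by
        ext x
        simp [C]
      rw [this]
      exact hc.inter_right (isClosed_iInter fun i =>
        isClosed_le (d σ i).continuous continuous_const)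
    · ext x
      simp only [C, hHeq, Set.mem_ofPred_eq, Set.mem_union, or_imp, forall_and,
        Set.forall_mem_range]
  · rintro _ ⟨σ, rfl⟩
    refine ⟨(LinearMap.pi fun i =>
      ((if i ∈ σ then coordFunctional ζ i else g i : StrongDual ℝ E) : E →ₗ[ℝ] ℝ)).toAffineMap, ?_⟩
    rintro x ⟨-, hx⟩
    funext i
    have hxi := hx i
    simp only [cellHomeo_apply, toCube, ← hg, LinearMap.coe_toAffineMap, LinearMap.pi_apply,
      ContinuousLinearMap.coe_coe]
    by_cases h : i ∈ σ
    · simp only [d, h, if_true, sub_apply, coordFunctional_apply] at hxi ⊢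
      exact min_eq_left (by linarith)
    · simp only [d, h, if_false, sub_apply, coordFunctional_apply] at hxi ⊢
      exact min_eq_right (by linarith)

theorem imageUnder_cellHomeo (hβ0 : 0 ≤ β) (I J : Set (Fin n)) :
    imageUnder (cellHomeo ζ hb hβ hβ1 hβ0) (dominantFace ζ b I J) = cubeFace I J := by
  have hiff (x : dominantCell ζ b) : (x : E) ∈ dominantFace ζ b I J ↔
      (cellHomeo ζ hb hβ hβ1 hβ0 x : Fin n → ℝ) ∈ cubeFace I J := by
    simp only [dominantFace, cubeFace, Set.mem_ofPred_eq, x.2, toCube_mem ζ hb hβ hβ1 x.2,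
      true_and, cellHomeo_apply, toCube_eq_one_iff ζ hb hβ hβ1 x.2, toCube_eq_zero_iff ζ hb hβ hβ1 x.2]
  ext t
  constructor
  · rintro ⟨x, hx, rfl⟩
    exact (hiff x).1 hx
  · intro ht
    obtain ⟨x, hx⟩ := (cellHomeo ζ hb hβ hβ1 hβ0).surjective ⟨t, ht.1⟩
    exact ⟨x, (hiff x).2 (by rwa [hx]), by rw [hx]⟩

omit hb hβ hβ1

theorem unitCube_eq : unitCube n = dominantCell (ContinuousLinearEquiv.refl ℝ (Fin n → ℝ)) 0 := by
  ext t
  simp [unitCube, dominantCell]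

theorem cubeFace_eq (I J : Set (Fin n)) :
    cubeFace I J = dominantFace (ContinuousLinearEquiv.refl ℝ (Fin n → ℝ)) 0 I J := by
  ext t
  simp [cubeFace, unitCube_eq, dominantFace, eq_comm]

theorem isFace_cubeFace (I J : Set (Fin n)) : IsFace (unitCube n) (cubeFace I J) := by
  rw [unitCube_eq, cubeFace_eq]
  exact isFace_dominantFace _ _ _ _

theorem exists_eq_cubeFace {F : Set (Fin n → ℝ)} (hF : IsFace (unitCube n) F) (hne : F.Nonempty) :
    ∃ I J, F = cubeFace I J := by
  simp only [cubeFace_eq]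
  rw [unitCube_eq] at hF
  exact exists_eq_dominantFace _ _ hF hne

end DominantCell

/-! ### Isomorphisms of face posets from bijections -/

section FaceIso

theorem isFace_empty {E : Type*} [TopologicalSpace E] [AddCommGroup E] [Module ℝ E] (P : Set E) :
    IsFace P ∅ :=
  fun h => absurd h Set.not_nonempty_empty

variable {E E' : Type*} {P : Set E} {Q : Set E'}

theorem imageUnder_subset_iff (h : P ≃ Q) {F G : Set E} (hF : F ⊆ P) :
    imageUnder h F ⊆ imageUnder h G ↔ F ⊆ G := by
  constructor
  · intro hs x hx
    obtain ⟨y, hy, hyx⟩ := hs ⟨⟨x, hF hx⟩, hx, rfl⟩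
    have : y = ⟨x, hF hx⟩ := h.injective (Subtype.ext hyx)
    rwa [this] at hy
  · rintro hs _ ⟨x, hx, rfl⟩
    exact ⟨x, hs hx, rfl⟩

theorem imageUnder_empty (h : P → Q) : imageUnder h ∅ = ∅ := by
  ext t
  simp [imageUnder]

variable [TopologicalSpace E] [AddCommGroup E] [Module ℝ E]
  [TopologicalSpace E'] [AddCommGroup E'] [Module ℝ E']

/-- A bijection of polytopes which matches up two families containing all nonempty faces induces an
isomorphism of face posets. -/
noncomputable def facePosetIso {κ : Type*} (h : P ≃ Q) (A : κ → Set E) (A' : κ → Set E')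
    (hA : ∀ k, IsFace P (A k)) (hA' : ∀ k, IsFace Q (A' k))
    (eA : ∀ F, IsFace P F → F.Nonempty → ∃ k, F = A k)
    (eA' : ∀ F, IsFace Q F → F.Nonempty → ∃ k, F = A' k)
    (himg : ∀ k, imageUnder h (A k) = A' k) : FacePoset P ≃o FacePoset Q :=
  RelIso.ofSurjective
    (OrderEmbedding.ofMapLEIff
      (fun F : FacePoset P => (⟨imageUnder h F.1, by
        obtain ⟨F, hF⟩ := F
        rcases F.eq_empty_or_nonempty with rfl | hne
        · rw [imageUnder_empty]
          exact isFace_empty _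
        · obtain ⟨k, rfl⟩ := eA F hF hne
          rw [himg]
          exact hA' k⟩ : FacePoset Q))
      fun F G => imageUnder_subset_iff h F.2.subset)
    (by
      rintro ⟨F, hF⟩
      rcases F.eq_empty_or_nonempty with rfl | hne
      · exact ⟨⟨∅, isFace_empty _⟩, Subtype.ext (imageUnder_empty _)⟩
      · obtain ⟨k, rfl⟩ := eA' F hF hne
        exact ⟨⟨A k, hA k⟩, Subtype.ext (himg k)⟩)

end FaceIso

/-! ### The combinatorial homeomorphism from the cell to the cube -/

section DominantCell

variable {E : Type*} [NormedAddCommGroup E] [NormedSpace ℝ E] {n : ℕ}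

theorem exists_combinatorialHomeo_unitCube (ζ : E ≃L[ℝ] (Fin n → ℝ))
    {b : Matrix (Fin n) (Fin n) ℝ} {β : ℝ} (hb : ∀ i j, 0 ≤ b i j) (hβ : ∀ i, ∑ j, b i j ≤ β)
    (hβ1 : β < 1) (hβ0 : 0 ≤ β) :
    ∃ (h : dominantCell ζ b ≃ₜ unitCube n)
      (c : FacePoset (dominantCell ζ b) ≃o FacePoset (unitCube n)),
      IsCombinatorialHomeoInducing h c ∧
      ∀ (I J : Set (Fin n)) (F : FacePoset (dominantCell ζ b)),
        (F : Set E) = dominantFace ζ b I J → (c F : Set (Fin n → ℝ)) = cubeFace I J := by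
  refine ⟨cellHomeo ζ hb hβ hβ1 hβ0,
    facePosetIso (κ := Set (Fin n) × Set (Fin n)) (cellHomeo ζ hb hβ hβ1 hβ0).toEquiv
      (fun k => dominantFace ζ b k.1 k.2)
      (fun k => cubeFace k.1 k.2) (fun k => isFace_dominantFace _ _ _ _)
      (fun k => isFace_cubeFace _ _)
      (fun F hF hne => by simpa using exists_eq_dominantFace ζ b hF hne)
      (fun F hF hne => by simpa using exists_eq_cubeFace hF hne)
      (fun k => imageUnder_cellHomeo ζ hb hβ hβ1 hβ0 k.1 k.2),
    ⟨isPiecewiseLinear_cellHomeo ζ hb hβ hβ1 hβ0, fun F => rfl⟩, ?_⟩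
  intro I J F hF
  rw [← imageUnder_cellHomeo ζ hb hβ hβ1 hβ0 I J, ← hF]
  rfl

end DominantCell

/-! ### Obtuse bases -/

section Obtuse

variable {V ι : Type*} [NormedAddCommGroup V] [InnerProductSpace ℝ V] [Fintype ι]

/-- A vector having positive inner products with the members of an obtuse basis has positive
coefficients in that basis. -/
theorem coeff_pos_of_obtuse {a : ι → V} (ha : LinearIndependent ℝ a)
    (hob : ∀ i j, i ≠ j → ⟪a i, a j⟫ ≤ 0) {c : ι → ℝ}
    (h : ∀ i, 0 < ⟪a i, ∑ j, c j • a j⟫) (i : ι) : 0 < c i := by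
  have hnonneg : ∀ i, 0 ≤ c i := by
    -- Split the vector as `p - m` by the signs of the coefficients. Then `⟪m, p - m⟫ ≥ 0`, while
    -- obtuseness gives `⟪m, p⟫ ≤ 0`; hence `m = 0`.
    set m : V := ∑ i, max (-c i) 0 • a i with hm
    set p : V := ∑ i, max (c i) 0 • a i with hp
    have hpm : ∑ j, c j • a j = p - m := by
      rw [hp, hm, ← Finset.sum_sub_distrib]
      refine Finset.sum_congr rfl fun j _ => ?_
      rw [← sub_smul]
      congr 1
      rcases le_total (c j) 0 with hc | hc
      · rw [max_eq_left (neg_nonneg.2 hc), max_eq_right hc]; ring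
      · rw [max_eq_right (neg_nonpos.2 hc), max_eq_left hc]; ring
    have h1 : 0 ≤ ⟪m, ∑ j, c j • a j⟫ := by
      rw [hm, sum_inner]
      refine Finset.sum_nonneg fun i _ => ?_
      rw [real_inner_smul_left]
      exact mul_nonneg (le_max_right _ _) (h i).le
    have h2 : ⟪m, p⟫ ≤ 0 := by
      rw [hm, hp, sum_inner]
      refine Finset.sum_nonpos fun i _ => ?_
      rw [inner_sum]
      refine Finset.sum_nonpos fun j _ => ?_
      rw [real_inner_smul_left, real_inner_smul_right]
      rcases eq_or_ne i j with rfl | hij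
      · rcases le_total (c i) 0 with hc | hc
        · simp [max_eq_right hc]
        · simp [max_eq_right (neg_nonpos.2 hc)]
      · exact mul_nonpos_of_nonneg_of_nonpos (le_max_right _ _)
          (mul_nonpos_of_nonneg_of_nonpos (le_max_right _ _) (hob i j hij))
    rw [hpm, inner_sub_right] at h1
    have h3 : m = 0 := inner_self_eq_zero.1 (le_antisymm (by linarith) (real_inner_self_nonneg (x := m)))
    intro i
    have := Fintype.linearIndependent_iff.1 ha _ h3 i
    linarith [le_max_left (-c i) 0]
  -- If `c i = 0`, only the nonpositive off-diagonal terms remain in the inner product with `a i`.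
  refine lt_of_le_of_ne (hnonneg i) fun hi => absurd (h i) (not_lt.2 ?_)
  rw [inner_sum]
  refine Finset.sum_nonpos fun j _ => ?_
  rw [real_inner_smul_right]
  rcases eq_or_ne i j with rfl | hij
  · simp [← hi]
  · exact mul_nonpos_of_nonneg_of_nonpos (hnonneg j) (hob i j hij)

end Obtuse

/-! ### The induced inner product and wall reflections -/

section DualInner

variable {V : Type*} [NormedAddCommGroup V] [InnerProductSpace ℝ V] [FiniteDimensional ℝ V]

theorem inner_gradVec (lam : StrongDual ℝ V) (x : V) : ⟪gradVec lam, x⟫ = lam x := by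
  have : CompleteSpace V := FiniteDimensional.complete ℝ V
  exact InnerProductSpace.toDual_symm_apply

theorem dualInner_eq_apply (lam mu : StrongDual ℝ V) : dualInner lam mu = lam (gradVec mu) :=
  inner_gradVec _ _

theorem dualInner_comm (lam mu : StrongDual ℝ V) : dualInner lam mu = dualInner mu lam :=
  real_inner_comm _ _

theorem dualInner_eq_apply' (lam mu : StrongDual ℝ V) : dualInner lam mu = mu (gradVec lam) := by
  rw [dualInner_comm, dualInner_eq_apply]

theorem gradVec_sum_smul {ι : Type*} (s : Finset ι) (c : ι → ℝ) (f : ι → StrongDual ℝ V) :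
    gradVec (∑ i ∈ s, c i • f i) = ∑ i ∈ s, c i • gradVec (f i) := by
  refine ext_inner_right ℝ fun x => ?_
  simp [inner_gradVec, sum_inner, real_inner_smul_left]

theorem dualInner_self_pos {α : StrongDual ℝ V} (hα : α ≠ 0) : 0 < dualInner α α := by
  refine real_inner_self_pos.2 fun h => hα ?_
  ext x
  rw [← inner_gradVec, h, inner_zero_left, zero_apply]

theorem apply_wallReflection (α lam : StrongDual ℝ V) (x : V) :
    lam (wallReflection α x) = lam x - 2 * (α x / dualInner α α) * dualInner α lam := by
  have : CompleteSpace V := FiniteDimensional.complete ℝ V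
  rw [wallReflection, Submodule.reflection_orthogonal_apply, Submodule.reflection_singleton_apply,
    inner_gradVec, dualInner_eq_apply' α lam]
  have : dualInner α α = ‖gradVec α‖ ^ 2 := real_inner_self_eq_norm_sq _
  rw [this]
  simp only [map_neg, map_sub, map_nsmul, map_smul, RCLike.ofReal_real_eq_id, id_eq, smul_eq_mul,
    nsmul_eq_mul]
  push_cast
  ring

end DualInner

/-! ### Simple roots, coweights and the chamber -/

section RootSystems

namespace SimpleRoots

variable {V : Type*} [NormedAddCommGroup V] [InnerProductSpace ℝ V] [FiniteDimensional ℝ V]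
  {R : EuclideanRootSystem V} {n : ℕ} (S : SimpleRoots R n)

theorem root_ne_zero (i : Fin n) : S.root i ≠ 0 :=
  R.ne_zero _ (S.root_mem i)

/-- Reflecting `α_j` in `α_i` leaves its `α_j`-coefficient equal to 1, so the new `α_i`-coefficient,
a negative multiple of `(α_i, α_j)`, cannot be negative. -/
theorem dualInner_root_nonpos {i j : Fin n} (hij : i ≠ j) :
    dualInner (S.root i) (S.root j) ≤ 0 := by
  have hpos := dualInner_self_pos (S.root_ne_zero i)
  rcases S.nonneg_or_nonpos _ (R.reflection_mem _ (S.root_mem i) _ (S.root_mem j)) with h | h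
  · have := h i
    simp only [map_sub, map_smul, Module.Basis.repr_self, Finsupp.coe_sub, Finsupp.coe_smul,
      Pi.sub_apply, Pi.smul_apply, Finsupp.single_apply, hij.symm, if_false, if_true,
      smul_eq_mul, mul_one, zero_sub] at this
    rw [neg_nonneg, div_nonpos_iff] at this
    rcases this with h | h <;> linarith [h.1, h.2]
  · have := h j
    simp [hij] at this
    linarith

/-- A nonzero functional is an open map, so `(α_i, ·)` sends interior points of `Δ*` to interior
points of `[0, ∞)`. -/
theorem dualInner_root_pos {l : StrongDual ℝ V} (hl : l ∈ interior S.dualChamber) (i : Fin n) :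
    0 < dualInner (S.root i) l := by
  let g : StrongDual ℝ (StrongDual ℝ V) :=
    ContinuousLinearMap.apply ℝ ℝ (gradVec (S.root i))
  have hg (lam : StrongDual ℝ V) : g lam = dualInner (S.root i) lam :=
    (dualInner_eq_apply' _ _).symm
  have hne : g ≠ 0 := fun h => by
    have := dualInner_self_pos (S.root_ne_zero i)
    rw [← hg, h, zero_apply] at this
    exact this.false
  have hopen : IsOpenMap g := g.isOpenMap_of_ne_zero hne
  have hsub : S.dualChamber ⊆ g ⁻¹' Set.Ici 0 := fun lam h => by
    rw [Set.mem_preimage, hg]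
    exact h i
  have := interior_mono hsub hl
  rw [← hopen.preimage_interior_eq_interior_preimage g.continuous, interior_Ici] at this
  rw [← hg]
  exact this

/-- The coordinates of `V` given by the simple roots. -/
noncomputable def rootCoord : V ≃ₗ[ℝ] (Fin n → ℝ) :=
  LinearMap.linearEquivOfInjective (LinearMap.pi fun i => (S.root i : V →ₗ[ℝ] ℝ))
    (by
      rw [← LinearMap.ker_eq_bot, LinearMap.ker_eq_bot']
      intro x hx
      have h (lam : StrongDual ℝ V) : lam x = 0 := by
        rw [← S.root.sum_repr lam, sum_apply]
        exact Finset.sum_eq_zero fun i _ => by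
          have : S.root i x = 0 := congrFun hx i
          simp [this]
      have := h (innerSL ℝ x)
      simpa using this)
    (by
      have : CompleteSpace V := FiniteDimensional.complete ℝ V
      rw [Module.finrank_fin_fun, ← Fintype.card_fin n, ← Module.finrank_eq_card_basis S.root]
      exact (InnerProductSpace.toDual ℝ V).toLinearEquiv.finrank_eq)

theorem rootCoord_apply (x : V) (i : Fin n) : S.rootCoord x i = S.root i x := rfl

/-- The basis of `V` dual to the simple roots. -/
noncomputable def coweight (i : Fin n) : V :=
  S.rootCoord.symm (Pi.single i 1)

theorem root_coweight (i j : Fin n) : S.root i (S.coweight j) = if i = j then 1 else 0 := by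
  rw [← rootCoord_apply, coweight, LinearEquiv.apply_symm_apply, Pi.single_apply]

theorem eq_of_forall_root_eq {x y : V} (h : ∀ i, S.root i x = S.root i y) : x = y :=
  S.rootCoord.injective (funext h)

theorem sum_root_smul_coweight (x : V) : ∑ j, S.root j x • S.coweight j = x := by
  refine S.eq_of_forall_root_eq fun i => ?_
  simp [root_coweight]

theorem sum_apply_coweight_smul_root (lam : StrongDual ℝ V) :
    ∑ j, lam (S.coweight j) • S.root j = lam := by
  ext x
  conv_rhs => rw [← S.sum_root_smul_coweight x, map_sum]
  simp [mul_comm]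

/-- The values of `l` at the coweights are its coefficients in the obtuse basis of simple roots. -/
theorem apply_coweight_pos {l : StrongDual ℝ V} (hl : l ∈ interior S.dualChamber) (i : Fin n) :
    0 < l (S.coweight i) := by
  have hsum (c : Fin n → ℝ) : gradVec (∑ i, c i • S.root i) = ∑ i, c i • gradVec (S.root i) :=
    gradVec_sum_smul _ _ _
  refine coeff_pos_of_obtuse (a := fun i => gradVec (S.root i)) (c := fun i => l (S.coweight i))
    (Fintype.linearIndependent_iff.2 fun c hc => ?_)
    (fun i j hij => S.dualInner_root_nonpos hij) (fun i => ?_) i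
  · refine Fintype.linearIndependent_iff.1 S.root.linearIndependent c ?_
    ext x
    rw [← inner_gradVec, hsum, hc, inner_zero_left, zero_apply]
  · rw [← hsum, S.sum_apply_coweight_smul_root]
    exact S.dualInner_root_pos hl i

/-- The vertex of the simplex `{x ∈ Δ | l x ≤ 1}` off the wall `α_i = 0`. -/
noncomputable def simplexVertex (l : StrongDual ℝ V) (i : Fin n) : V :=
  (l (S.coweight i))⁻¹ • S.coweight i

/-! ### Vertices of the simplex `Δ ∩ B` -/

section Simplex

variable {l : StrongDual ℝ V} (hl : ∀ i, 0 < l (S.coweight i))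
include hl

theorem coweight_eq_smul_simplexVertex (i : Fin n) :
    S.coweight i = l (S.coweight i) • S.simplexVertex l i := by
  rw [simplexVertex, smul_inv_smul₀ (hl i).ne']

theorem simplexVertex_mem (i : Fin n) :
    S.simplexVertex l i ∈ {x ∈ S.chamber | l x ≤ 1} := by
  refine ⟨fun j => ?_, ?_⟩
  · rw [simplexVertex, map_smul, root_coweight, smul_eq_mul]
    have := inv_nonneg.2 (hl i).le
    split_ifs <;> simp [this]
  · rw [simplexVertex, map_smul, smul_eq_mul, inv_mul_cancel₀ (hl i).ne']

theorem root_simplexVertex_self_pos (i : Fin n) : 0 < S.root i (S.simplexVertex l i) := by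
  rw [simplexVertex, map_smul, root_coweight]
  simpa using hl i

theorem apply_simplexVertex_self (i : Fin n) : l (S.simplexVertex l i) = 1 := by
  rw [simplexVertex, map_smul, smul_eq_mul, inv_mul_cancel₀ (hl i).ne']

omit hl in
theorem apply_eq_sum (lam : StrongDual ℝ V) (x : V) :
    lam x = ∑ j, lam (S.coweight j) * S.root j x := by
  conv_lhs => rw [← S.sum_apply_coweight_smul_root lam]
  simp

omit hl in
theorem root_simplexVertex_of_ne {i j : Fin n} (hij : j ≠ i) :
    S.root j (S.simplexVertex l i) = 0 := by
  rw [simplexVertex, map_smul, root_coweight, if_neg hij, smul_zero]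

omit hl in
theorem eq_simplexVertex {x : V} {i : Fin n} (hx : ∀ j, j ≠ i → S.root j x = 0) (hlx : l x = 1) :
    x = S.simplexVertex l i := by
  refine S.eq_of_forall_root_eq fun j => ?_
  rcases eq_or_ne j i with rfl | hj
  · have h1 := S.apply_eq_sum l x
    rw [Finset.sum_eq_single j (fun k _ hk => by rw [hx k hk, mul_zero]) (by simp), hlx] at h1
    rw [simplexVertex, map_smul, root_coweight, if_pos rfl, smul_eq_mul, mul_one]
    exact eq_inv_of_mul_eq_one_right h1.symm
  · rw [hx j hj, S.root_simplexVertex_of_ne hj]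

theorem simplexVertex_mem_extremePoints (i : Fin n) :
    S.simplexVertex l i ∈ {x ∈ S.chamber | l x ≤ 1}.extremePoints ℝ := by
  refine ⟨S.simplexVertex_mem hl i, ?_⟩
  rintro x ⟨hx, hlx⟩ y ⟨hy, hly⟩ ⟨a, b, ha, hb, hab, hxy⟩
  refine S.eq_simplexVertex (fun j hj => ?_) ?_
  · have h := congrArg (S.root j) hxy
    rw [S.root_simplexVertex_of_ne hj, map_add, map_smul, map_smul, smul_eq_mul, smul_eq_mul] at h
    nlinarith [hx j, hy j, mul_nonneg hb.le (hy j)]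
  · have h := congrArg l hxy
    rw [S.apply_simplexVertex_self hl, map_add, map_smul, map_smul, smul_eq_mul, smul_eq_mul] at h
    nlinarith

/-- Here `θ` is the weight of the `i`-th vertex in `x`. If `θ < 1`, then `x` lies strictly between
that vertex and the rescaled remainder, so extremality identifies it with the vertex; if `θ = 1`,
the other weights vanish. -/
theorem eq_simplexVertex_of_mem_extremePoints {i : Fin n} {x : V}
    (hx : x ∈ {x ∈ S.chamber | l x ≤ 1}.extremePoints ℝ) (hi : S.root i x ≠ 0) :
    x = S.simplexVertex l i := by
  obtain ⟨⟨hxc, hxl⟩, hext⟩ := hx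
  set θ : ℝ := l (S.coweight i) * S.root i x with hθ
  have hθ0 : 0 < θ := mul_pos (hl i) (lt_of_le_of_ne (hxc i) hi.symm)
  have hterm (j : Fin n) : 0 ≤ l (S.coweight j) * S.root j x := mul_nonneg (hl j).le (hxc j)
  have hsum := S.apply_eq_sum l x
  rw [← Finset.add_sum_erase _ _ (Finset.mem_univ i), ← hθ] at hsum
  have hrest : 0 ≤ ∑ j ∈ Finset.univ.erase i, l (S.coweight j) * S.root j x :=
    Finset.sum_nonneg fun j _ => hterm j
  rcases (show θ ≤ 1 by linarith).lt_or_eq with h1 | h1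
  · have h1' : 0 < 1 - θ := by linarith
    symm
    refine hext (S.simplexVertex_mem hl i)
      (x₂ := (1 - θ)⁻¹ • (x - θ • S.simplexVertex l i)) ⟨fun j => ?_, ?_⟩
      ⟨θ, 1 - θ, hθ0, h1', by ring, ?_⟩
    · rw [map_smul, map_sub, map_smul, smul_eq_mul]
      refine mul_nonneg (inv_nonneg.2 h1'.le) ?_
      rcases eq_or_ne j i with rfl | hj
      · rw [simplexVertex, map_smul, root_coweight, if_pos rfl, smul_eq_mul, smul_eq_mul, mul_one,
          hθ, mul_right_comm, mul_inv_cancel₀ (hl j).ne', one_mul, sub_self]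
      · rw [S.root_simplexVertex_of_ne hj]
        simpa using hxc j
    · rw [map_smul, map_sub, map_smul, S.apply_simplexVertex_self hl, smul_eq_mul, smul_eq_mul,
        inv_mul_le_iff₀ h1']
      linarith
    · rw [smul_inv_smul₀ h1'.ne']
      abel
  · have h0 := (Finset.sum_eq_zero_iff_of_nonneg fun j _ => hterm j).1
      (le_antisymm (by linarith) hrest)
    refine S.eq_simplexVertex (fun j hj => ?_) (by linarith)
    exact (mul_eq_zero.1 (h0 j (by simpa using hj))).resolve_left (hl j).ne'

theorem apply_le_one_of_mem_simplex {lam : StrongDual ℝ V}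
    (h : ∀ i, lam (S.simplexVertex l i) ≤ 1) {x : V} (hx : x ∈ {x ∈ S.chamber | l x ≤ 1}) :
    lam x ≤ 1 := by
  refine le_trans ?_ hx.2
  rw [S.apply_eq_sum lam x, S.apply_eq_sum l x]
  refine Finset.sum_le_sum fun j _ => mul_le_mul_of_nonneg_right ?_ (hx.1 j)
  rw [S.coweight_eq_smul_simplexVertex hl j, map_smul, map_smul, S.apply_simplexVertex_self hl,
    smul_eq_mul, smul_eq_mul]
  exact mul_le_mul_of_nonneg_left (h j) (hl j).le

end Simplex

/-- A dominant functional attains on the chamber every lower bound which it attains on an invariant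
compact set. -/
theorem exists_mem_chamber_apply_ge {B : Set V} (hB : IsCompact B)
    (hBW : ∀ w ∈ R.weylGroup, w '' B = B) {l lam : StrongDual ℝ V}
    (hl : l ∈ interior S.dualChamber) (hlam : lam ∈ S.dualChamber) {x : V} (hx : x ∈ B) :
    ∃ y ∈ S.chamber ∩ B, lam x ≤ lam y := by
  -- Maximise `l` over the points of `B` where `lam` is at least `lam x`. If `α_i` were negative at
  -- the maximiser, reflecting in its wall would strictly raise `l` without lowering `lam`.
  have hK : IsCompact (B ∩ {y | lam x ≤ lam y}) :=
    hB.inter_right (isClosed_le continuous_const lam.continuous)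
  obtain ⟨y, ⟨hyB, hy⟩, hmax⟩ := hK.exists_isMaxOn ⟨x, hx, le_refl (lam x)⟩ l.continuous.continuousOn
  refine ⟨y, ⟨fun i => ?_, hyB⟩, hy⟩
  by_contra! hneg
  have hpos : 0 < -(2 * (S.root i y / dualInner (S.root i) (S.root i))) := by
    have := div_neg_of_neg_of_pos hneg (dualInner_self_pos (S.root_ne_zero i))
    linarith
  have hmem : wallReflection (S.root i) y ∈ B := by
    rw [← hBW _ (Subgroup.subset_closure ⟨_, S.root_mem i, rfl⟩)]
    exact ⟨y, hyB, rfl⟩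
  have hge : lam x ≤ lam (wallReflection (S.root i) y) := by
    rw [apply_wallReflection]
    have hy' : lam x ≤ lam y := hy
    linarith [mul_nonneg hpos.le (hlam i)]
  have hlt := hmax ⟨hmem, hge⟩
  rw [Set.mem_ofPred_eq, apply_wallReflection] at hlt
  linarith [mul_pos hpos (S.dualInner_root_pos hl i)]

/-! ### The dual chamber in vertex coordinates -/

section DualCoordinates

variable {l : StrongDual ℝ V} (hl : ∀ i, 0 < l (S.coweight i))

/-- The coordinates of the dual space given by the values at the vertices of the simplex. -/
noncomputable def vertexCoord : StrongDual ℝ V ≃L[ℝ] (Fin n → ℝ) :=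
  (LinearMap.linearEquivOfInjective
    (LinearMap.pi fun i =>
      (ContinuousLinearMap.apply ℝ ℝ (S.simplexVertex l i) : StrongDual ℝ V →ₗ[ℝ] ℝ))
    (by
      rw [← LinearMap.ker_eq_bot, LinearMap.ker_eq_bot']
      intro lam hlam
      have h (i : Fin n) : lam (S.simplexVertex l i) = 0 := congrFun hlam i
      rw [← S.sum_apply_coweight_smul_root lam]
      refine Finset.sum_eq_zero fun i _ => ?_
      rw [S.coweight_eq_smul_simplexVertex hl i, map_smul, h, smul_zero, zero_smul])
    (by rw [Module.finrank_fin_fun, Module.finrank_eq_card_basis S.root, Fintype.card_fin])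
    ).toContinuousLinearEquiv

@[simp]
theorem vertexCoord_apply (lam : StrongDual ℝ V) (i : Fin n) :
    S.vertexCoord hl lam i = lam (S.simplexVertex l i) := rfl

variable (l) in
/-- The matrix of the inequalities defining the dual chamber in the coordinates `vertexCoord`. -/
noncomputable def chamberMatrix : Matrix (Fin n) (Fin n) ℝ :=
  fun i j => if i = j then 0 else
    -(dualInner (S.root i) (S.root j) * l (S.coweight j)) /
      (dualInner (S.root i) (S.root i) * l (S.coweight i))

include hl

theorem chamberMatrix_nonneg (i j : Fin n) : 0 ≤ S.chamberMatrix l i j := by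
  rw [chamberMatrix]
  split_ifs with h
  · exact le_rfl
  · refine div_nonneg ?_ (mul_pos (dualInner_self_pos (S.root_ne_zero i)) (hl i)).le
    exact neg_nonneg.2 (mul_nonpos_of_nonpos_of_nonneg (S.dualInner_root_nonpos h) (hl j).le)

/-- Expand `lam` in the simple roots, with coefficients `l (S.coweight j)` times the vertex
coordinates, and factor out the diagonal term. -/
theorem dualInner_root_eq (lam : StrongDual ℝ V) (i : Fin n) :
    dualInner (S.root i) lam = dualInner (S.root i) (S.root i) * l (S.coweight i) *
      (S.vertexCoord hl lam i - (S.chamberMatrix l).mulVec (S.vertexCoord hl lam) i) := by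
  have hne := (mul_pos (dualInner_self_pos (S.root_ne_zero i)) (hl i)).ne'
  have h1 : dualInner (S.root i) lam = ∑ j, dualInner (S.root i) (S.root j) * l (S.coweight j) *
      S.vertexCoord hl lam j := by
    conv_lhs => rw [dualInner_eq_apply', ← S.sum_apply_coweight_smul_root lam, sum_apply]
    refine Finset.sum_congr rfl fun j _ => ?_
    rw [smul_apply, ← dualInner_eq_apply', vertexCoord_apply]
    conv_lhs => rw [S.coweight_eq_smul_simplexVertex hl j, map_smul]
    simp only [smul_eq_mul]
    ring
  rw [h1, ← Finset.add_sum_erase _ _ (Finset.mem_univ i), mul_sub, sub_eq_add_neg]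
  congr 1
  rw [Matrix.mulVec, dotProduct, ← Finset.add_sum_erase _ _ (Finset.mem_univ i), chamberMatrix,
    if_pos rfl, zero_mul, zero_add, Finset.mul_sum, ← Finset.sum_neg_distrib]
  refine Finset.sum_congr rfl fun j hj => ?_
  rw [chamberMatrix, if_neg (Finset.ne_of_mem_erase hj).symm]
  rw [← mul_assoc, mul_div_cancel₀ _ hne, neg_mul, neg_neg]

theorem dualInner_root_nonneg_iff (lam : StrongDual ℝ V) (i : Fin n) :
    0 ≤ dualInner (S.root i) lam ↔
      (S.chamberMatrix l).mulVec (S.vertexCoord hl lam) i ≤ S.vertexCoord hl lam i := by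
  rw [S.dualInner_root_eq hl lam i,
    mul_nonneg_iff_of_pos_left (mul_pos (dualInner_self_pos (S.root_ne_zero i)) (hl i)), sub_nonneg]

theorem dualInner_root_eq_zero_iff (lam : StrongDual ℝ V) (i : Fin n) :
    dualInner (S.root i) lam = 0 ↔
      (S.chamberMatrix l).mulVec (S.vertexCoord hl lam) i = S.vertexCoord hl lam i := by
  rw [S.dualInner_root_eq hl lam i, mul_eq_zero,
    or_iff_right (mul_pos (dualInner_self_pos (S.root_ne_zero i)) (hl i)).ne', sub_eq_zero, eq_comm]

/-- All vertex coordinates of `l` are 1, so `(α_i, l) > 0` says precisely that the `i`-th row sum is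
below 1. -/
theorem sum_chamberMatrix_lt_one (hpos : ∀ i, 0 < dualInner (S.root i) l) (i : Fin n) :
    ∑ j, S.chamberMatrix l i j < 1 := by
  have h := hpos i
  rw [S.dualInner_root_eq hl l i,
    mul_pos_iff_of_pos_left (mul_pos (dualInner_self_pos (S.root_ne_zero i)) (hl i))] at h
  simpa [Matrix.mulVec, dotProduct, S.apply_simplexVertex_self hl] using h

end DualCoordinates

/-! ### Identification of `Δ* ∩ B*` with a cell -/

section DualPiece

variable {B : Set V} {l : StrongDual ℝ V} (hB : IsCompact B)
  (hBW : ∀ w ∈ R.weylGroup, w '' B = B) (hl : l ∈ interior S.dualChamber)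
  (hΔB : S.chamber ∩ B = {x ∈ S.chamber | l x ≤ 1})
include hB hBW hΔB

theorem dualPiece_eq_dominantCell : S.dualPiece B =
    dominantCell (S.vertexCoord (S.apply_coweight_pos hl)) (S.chamberMatrix l) := by
  have hc := S.apply_coweight_pos hl
  ext lam
  simp only [dominantCell, Set.mem_ofPred_eq, forall_and, ← S.dualInner_root_nonneg_iff hc]
  refine and_congr_right fun hlam => ⟨fun h i => ?_, fun h x hx => ?_⟩
  · have : S.simplexVertex l i ∈ S.chamber ∩ B := hΔB ▸ S.simplexVertex_mem hc i
    exact h _ this.2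
  · obtain ⟨y, hy, hxy⟩ := S.exists_mem_chamber_apply_ge hB hBW hl hlam hx
    rw [hΔB] at hy
    exact hxy.trans (S.apply_le_one_of_mem_simplex hc h hy)

theorem exteriorFace_inter_interiorFace_eq (I J : Set (Fin n)) :
    S.exteriorFace B (S.simplexVertex l) I ∩ S.interiorFace B J =
      dominantFace (S.vertexCoord (S.apply_coweight_pos hl)) (S.chamberMatrix l) I J := by
  have hc := S.apply_coweight_pos hl
  ext lam
  simp only [exteriorFace, interiorFace, dominantFace, Set.mem_inter_iff, Set.mem_ofPred_eq,
    S.dualPiece_eq_dominantCell hB hBW hl hΔB, dualInner_comm lam,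
    S.dualInner_root_eq_zero_iff hc, vertexCoord_apply]
  tauto

end DualPiece

theorem isVertexOff_iff {B : Set V} {l : StrongDual ℝ V} (hl : ∀ i, 0 < l (S.coweight i))
    (hΔB : S.chamber ∩ B = {x ∈ S.chamber | l x ≤ 1}) {i : Fin n} {v : V} :
    S.IsVertexOff B i v ↔ v = S.simplexVertex l i := by
  rw [IsVertexOff, hΔB]
  constructor
  · rintro ⟨h, hi⟩
    exact S.eq_simplexVertex_of_mem_extremePoints hl h hi
  · rintro rfl
    exact ⟨S.simplexVertex_mem_extremePoints hl i, (S.root_simplexVertex_self_pos hl i).ne'⟩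

end SimpleRoots

end RootSystems

theorem theorem6 {V : Type*} [NormedAddCommGroup V] [InnerProductSpace ℝ V]
    [FiniteDimensional ℝ V] (R : EuclideanRootSystem V) {n : ℕ} (S : SimpleRoots R n)
    (B : Set V) (hB : IsPolytope B) (hBint : (interior B).Nonempty)
    (hBW : ∀ w ∈ R.weylGroup, w '' B = B)
    (l : StrongDual ℝ V) (hl : l ∈ interior S.dualChamber)
    (hΔB : S.chamber ∩ B = {x ∈ S.chamber | l x ≤ 1}) :
    IsPolytope (S.dualPiece B) ∧
    (∀ i, ∃! v : V, S.IsVertexOff B i v) ∧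
    ∀ ω : Fin n → V, (∀ i, S.IsVertexOff B i (ω i)) →
      (∀ I J : Set (Fin n), IsFace (S.dualPiece B) (S.exteriorFace B ω I ∩ S.interiorFace B J)) ∧
      (∀ F : Set (StrongDual ℝ V), IsFace (S.dualPiece B) F → F.Nonempty →
        ∃ I J : Set (Fin n), F = S.exteriorFace B ω I ∩ S.interiorFace B J) ∧
      ∃ (h : S.dualPiece B ≃ₜ unitCube n) (c : FacePoset (S.dualPiece B) ≃o FacePoset (unitCube n)),
        IsCombinatorialHomeoInducing h c ∧
        ∀ (I J : Set (Fin n)) (F : FacePoset (S.dualPiece B)),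
          (F : Set (StrongDual ℝ V)) = S.exteriorFace B ω I ∩ S.interiorFace B J →
            (c F : Set (Fin n → ℝ)) = cubeFace I J := by
  have hc := S.apply_coweight_pos hl
  have hb := S.chamberMatrix_nonneg hc
  -- The largest row sum serves as `β`; for `n = 0` there are no rows and `β = 0` is used.
  obtain ⟨β, hβ0, hβ1, hβ⟩ : ∃ β : ℝ, 0 ≤ β ∧ β < 1 ∧ ∀ i, ∑ j, S.chamberMatrix l i j ≤ β := by
    have hlt := S.sum_chamberMatrix_lt_one hc (S.dualInner_root_pos hl)
    rcases isEmpty_or_nonempty (Fin n) with _ | _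
    · exact ⟨0, le_rfl, zero_lt_one, fun i => isEmptyElim i⟩
    · obtain ⟨k, hk⟩ := Finite.exists_max fun i => ∑ j, S.chamberMatrix l i j
      exact ⟨_, Finset.sum_nonneg fun j _ => hb k j, hlt k, hk⟩
  have hcell := S.dualPiece_eq_dominantCell hB.1 hBW hl hΔB
  have hface := S.exteriorFace_inter_interiorFace_eq hB.1 hBW hl hΔB
  simp only [S.isVertexOff_iff hc hΔB]
  refine ⟨?_, fun i => existsUnique_eq, ?_⟩
  · rw [hcell]
    exact isPolytope_dominantCell _ hb hβ hβ1
  intro ω hω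
  obtain rfl : ω = S.simplexVertex l := funext hω
  simp only [hface]
  -- The types of `h` and `c` depend on the polytope, so it is made a variable and substituted
  -- rather than rewritten.
  generalize S.dualPiece B = P at hcell
  subst hcell
  exact ⟨isFace_dominantFace _ _, fun F hF hne => exists_eq_dominantFace _ _ hF hne,
    exists_combinatorialHomeo_unitCube _ hb hβ hβ1 hβ0⟩
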